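/- For $n=1,2,\dots$ let $C_n=(V_n,E_n)$ be the hypercube skeleton: $V_n=\{0,1\}^n$, with $u,v\in V_n$ adjacent iff $\|u-v\|_1=1$. Regard $V_n\subseteq V_{n+1}$ by appending a coordinate $0$, so that the origin $\vec 0$ is common to all $V_n$. Let $P_n$ be the transition matrix of the simple random walk on $C_n$: $P_n(u,v)=1/n$ if $\|u-v\|_1=1$, and $P_n(u,v)=0$ otherwise. Let $\mathfrak d\colon\mathbb Z_{>0}\to\mathbb Z_{\ge 0}$ be a duration function, and put $T_0=0$ and $T_n=\sum_{i=1}^n\mathfrak d(i)$. Let $X_0,X_1,X_2,\dots$ be the random walk on the growing hypercube with durations $\mathfrak d$ started at $\vec 0$, that is, the Markov process with $X_0=\vec 0$ almost surely whose transition from $X_t$ to $X_{t+1}$ follows $P_n$ whenever $T_{n-1}\le t<T_n$. If $\mathfrak d(n)=\Omega(n2^n)$ as $n\to\infty$ (that is, there is a constant $c>0$ with $\mathfrak d(n)\ge c\,n2^n$ for all sufficiently large $n$), then for every integer $m\ge 1$ and every vertex $v\in V_m$, almost surely $X_t=v$ for infinitely many $t$. -/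

import Mathlib

open MeasureTheory Filter

/-- The end `T_n = 𝔡(1) + ⋯ + 𝔡(n)` of phase `n` (so `T_0 = 0`), for a duration function `𝔡` on the
positive integers; the value `d 0` is never used. -/
def phaseEnd (d : ℕ → ℕ) (n : ℕ) : ℕ := ∑ i ∈ Finset.Icc 1 n, d i

/-- `X₀, X₁, X₂, …` is a random walk on a growing graph with durations `d`, transition matrices
`P 1, P 2, …` and initial vertex `x₀`: it starts at `x₀` and, for `t ∈ [T_{n-1}, T_n)` (phase `n`,
written as `n + 1` below), given the whole past `X₀ = x 0, …, X_t = x t` it jumps to `x (t + 1)`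
with probability `P n (x t) (x (t + 1))`. All vertices live in a common countable set `S`, so
measurability of `X t` is measurability of the events `X t = x`. -/
structure IsGrowingGraphWalk {S : Type*} [Countable S] (d : ℕ → ℕ) (P : ℕ → S → S → ℝ) (x₀ : S)
    {Ω : Type*} [MeasurableSpace Ω] (μ : Measure Ω) (X : ℕ → Ω → S) : Prop where
  measurableSet_eq : ∀ t x, MeasurableSet {ω | X t ω = x}
  start : ∀ᵐ ω ∂μ, X 0 ω = x₀
  step : ∀ n t, phaseEnd d n ≤ t → t < phaseEnd d (n + 1) → ∀ x : ℕ → S,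
    μ.real {ω | ∀ s ≤ t + 1, X s ω = x s} =
      μ.real {ω | ∀ s ≤ t, X s ω = x s} * P (n + 1) (x t) (x (t + 1))

/-- The vertex set `V_n = {0,1}^n` of the hypercube skeleton `C_n`, inside the finitely supported
integer sequences: a vector of length `n` is continued by zeros, which is the identification that
makes `V_n ⊆ V_{n+1}` and the origin common to all `V_n`. -/
def cubeVertices (n : ℕ) : Set (ℕ →₀ ℤ) :=
  {u | (∀ i, u i = 0 ∨ u i = 1) ∧ ∀ i, n ≤ i → u i = 0}

/-- The norm `‖w‖₁ = ∑ i, |w i|`. -/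
def l1Norm (w : ℕ →₀ ℤ) : ℤ := w.sum fun _ a => |a|

open Classical in
/-- The transition matrix of the simple random walk on `C_n`: each of the `n` neighbours has
probability `1 / n`. (All entries outside `V_n × V_n` are zero.) -/
noncomputable def cubeTransition (n : ℕ) (u v : ℕ →₀ ℤ) : ℝ :=
  if u ∈ cubeVertices n ∧ v ∈ cubeVertices n ∧ l1Norm (u - v) = 1 then 1 / (n : ℝ) else 0

/-! ### The expected hitting times of the hypercube -/

/-! While the walk moves on the `(n + 1)`-cube, let `h` be the expected hitting time of `v`, a
function of the distance to `v`. Off `v`, one step lowers the mean of `h` by exactly 1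
(`hittingTime_harmonic`, `sum_cubeTransition_mul_hittingTime`), and `h ≤ 3 * 2 ^ (n + 1)` for every
starting vertex (`hittingTime_le`).

Hence the mean of `h` on the event that `v` has been avoided since the phase began drops at each
step by the probability of that event (`meanRemainingTime_succ`). Since this mean stays nonnegative,
telescoping over the phase bounds duration times the probability of avoiding `v` from then on by `3
* 2 ^ (n + 1)`. Durations of order `n * 2 ^ n` make that probability `O(1 / n)`. Avoiding `v` from a
fixed time on implies avoiding it from the start of every late phase, so it has probability zero; a
countable union over times concludes. No independence between phases is needed. -/

/-- The expected time that the simple random walk on the `(N + 1)`-dimensional hypercube needs to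
get from distance `i + 1` to distance `i` of a given vertex. -/
noncomputable def descentTime (N i : ℕ) : ℝ :=
  (∑ k ∈ Finset.Ioc i (N + 1), ((N + 1).choose k : ℝ)) / (N.choose i : ℝ)

/-- The expected time that the simple random walk on the `(N + 1)`-dimensional hypercube needs to
hit a given vertex at distance `j`. -/
noncomputable def hittingTime (N j : ℕ) : ℝ := ∑ i ∈ Finset.range j, descentTime N i

lemma descentTime_nonneg (N i : ℕ) : 0 ≤ descentTime N i := by
  unfold descentTime; positivity

lemma hittingTime_nonneg (N j : ℕ) : 0 ≤ hittingTime N j :=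
  Finset.sum_nonneg fun i _ => descentTime_nonneg N i

/-- First-step analysis at distance `i + 1`: `i + 1` of the `N + 1` neighbours are closer, and from
the other `N - i` the walk must descend two levels. -/
lemma descentTime_recurrence {N i : ℕ} (hi : i ≤ N) :
    ((i : ℝ) + 1) * descentTime N i = N + 1 + ((N : ℝ) - i) * descentTime N (i + 1) := by
  have hpos : (0 : ℝ) < N.choose i := by exact_mod_cast Nat.choose_pos hi
  have hsum : ∑ k ∈ Finset.Ioc i (N + 1), ((N + 1).choose k : ℝ) =
      (N + 1).choose (i + 1) + ∑ k ∈ Finset.Ioc (i + 1) (N + 1), ((N + 1).choose k : ℝ) := by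
    rw [← Finset.sum_Ioc_consecutive _ (Nat.le_succ i) (by omega : i + 1 ≤ N + 1)]
    simp
  have h1 : ((N + 1 : ℝ)) * N.choose i = (N + 1).choose (i + 1) * (i + 1) := by
    exact_mod_cast Nat.add_one_mul_choose_eq N i
  unfold descentTime
  rw [hsum]
  -- For `i = N` the next denominator `N.choose (N + 1)` is zero, but its coefficient `N - i`
  -- vanishes too.
  rcases hi.eq_or_lt with rfl | hlt
  · simp
  · have hpos' : (0 : ℝ) < N.choose (i + 1) := by exact_mod_cast Nat.choose_pos hlt
    have h2 : (N.choose (i + 1) : ℝ) * (i + 1) = N.choose i * (N - i) := by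
      have := Nat.choose_succ_right_eq N i
      rw [← Nat.cast_sub hi]
      exact_mod_cast this
    set s := ∑ k ∈ Finset.Ioc (i + 1) (N + 1), ((N + 1).choose k : ℝ)
    field_simp
    linear_combination (-(N.choose (i + 1) : ℝ)) * h1 + s * h2

lemma hittingTime_harmonic {N j : ℕ} (hj : j ≤ N) :
    ((j : ℝ) + 1) * hittingTime N j + ((N : ℝ) - j) * hittingTime N (j + 2) =
      (N + 1) * hittingTime N (j + 1) - (N + 1) := by
  have h := descentTime_recurrence hj
  simp only [hittingTime, Finset.sum_range_succ]
  linear_combination -h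

lemma descentTime_le (N i : ℕ) : descentTime N i ≤ 2 ^ (N + 1) * (1 / (N.choose i : ℝ)) := by
  unfold descentTime
  rw [mul_one_div]
  gcongr
  have h : ∑ k ∈ Finset.range (N + 1 + 1), ((N + 1).choose k : ℝ) = 2 ^ (N + 1) := by
    exact_mod_cast Nat.sum_range_choose (N + 1)
  rw [← h]
  refine Finset.sum_le_sum_of_subset_of_nonneg (fun k hk => ?_) fun _ _ _ => by positivity
  simp at hk ⊢
  omega

lemma le_choose {N i : ℕ} (hi : 1 ≤ i) (hiN : i + 1 ≤ N) : N ≤ N.choose i := by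
  induction N generalizing i with
  | zero => omega
  | succ N ih =>
    obtain ⟨k, rfl⟩ : ∃ k, i = k + 1 := ⟨i - 1, by omega⟩
    rw [Nat.choose_succ_succ']
    rcases (by omega : k + 1 = N ∨ k + 1 + 1 ≤ N) with h | h
    · subst h
      simp
    · have h1 := ih (by omega) h
      have h2 : 0 < N.choose k := Nat.choose_pos (by omega)
      omega

/-- The two end terms are 1 each and the interior ones at most `1 / N` each. A bound independent of
`N` is essential: an extra factor `N` in the hitting time would cancel the factor `n` in the
durations. -/
lemma sum_one_div_choose_le (N : ℕ) :
    ∑ i ∈ Finset.range (N + 1), 1 / (N.choose i : ℝ) ≤ 3 := by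
  rcases Nat.eq_zero_or_pos N with rfl | hN
  · norm_num
  obtain ⟨M, rfl⟩ : ∃ M, N = M + 1 := ⟨N - 1, by omega⟩
  rw [Finset.sum_range_succ, Finset.sum_range_succ']
  have h : ∑ i ∈ Finset.range M, 1 / ((M + 1).choose (i + 1) : ℝ) ≤ 1 := by
    calc ∑ i ∈ Finset.range M, 1 / ((M + 1).choose (i + 1) : ℝ)
        ≤ ∑ i ∈ Finset.range M, 1 / ((M : ℝ) + 1) := by
          refine Finset.sum_le_sum fun i hi => ?_
          have hi' := Finset.mem_range.1 hi
          have : ((M : ℝ) + 1) ≤ (M + 1).choose (i + 1) := by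
            exact_mod_cast le_choose (by omega) (by omega)
          gcongr
      _ ≤ 1 := by
          rw [Finset.sum_const, Finset.card_range, nsmul_eq_mul, mul_one_div,
            div_le_one (by positivity)]
          linarith
  norm_num at h ⊢
  linarith

lemma hittingTime_le {N j : ℕ} (hj : j ≤ N + 1) : hittingTime N j ≤ 3 * 2 ^ (N + 1) := by
  calc hittingTime N j ≤ hittingTime N (N + 1) :=
        Finset.sum_le_sum_of_subset_of_nonneg (Finset.range_mono hj)
          fun i _ _ => descentTime_nonneg N i
    _ ≤ ∑ i ∈ Finset.range (N + 1), 2 ^ (N + 1) * (1 / (N.choose i : ℝ)) :=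
        Finset.sum_le_sum fun i _ => descentTime_le N i
    _ ≤ 3 * 2 ^ (N + 1) := by
        rw [← Finset.mul_sum, mul_comm]
        gcongr
        exact sum_one_div_choose_le N

/-! ### Neighbours in the hypercube -/

lemma cubeVertices_mono {m n : ℕ} (h : m ≤ n) : cubeVertices m ⊆ cubeVertices n :=
  fun _ hu => ⟨hu.1, fun i hi => hu.2 i (h.trans hi)⟩

lemma finite_cubeVertices (n : ℕ) : (cubeVertices n).Finite := by
  refine Set.Finite.of_injOn (f := fun u : ℕ →₀ ℤ => u.support)
    (t := ((Finset.range n).powerset : Set (Finset ℕ))) ?_ ?_ (Finset.finite_toSet _)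
  · intro u hu
    simp only [Finset.coe_powerset, Set.mem_preimage, Set.mem_powerset_iff, Finset.coe_subset]
    intro i hi
    by_contra hin
    exact Finsupp.mem_support_iff.1 hi (hu.2 i (by simpa using hin))
  · intro u hu w hw h
    ext i
    have hi : u i ≠ 0 ↔ w i ≠ 0 := by
      rw [← Finsupp.mem_support_iff, ← Finsupp.mem_support_iff]
      exact iff_of_eq (congrArg (i ∈ ·) h)
    rcases hu.1 i with h1 | h1 <;> rcases hw.1 i with h2 | h2 <;> simp_all

/-- Flip the `i`-th coordinate of a `0`-`1` vector. -/
noncomputable def flipCoord (u : ℕ →₀ ℤ) (i : ℕ) : ℕ →₀ ℤ := u.update i (1 - u i)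

lemma flipCoord_apply (u : ℕ →₀ ℤ) (i j : ℕ) :
    flipCoord u i j = if j = i then 1 - u i else u j := by
  classical
  simp [flipCoord, Finsupp.update_apply]

lemma flipCoord_mem {n : ℕ} {u : ℕ →₀ ℤ} (hu : u ∈ cubeVertices n) {i : ℕ} (hi : i < n) :
    flipCoord u i ∈ cubeVertices n := by
  refine ⟨fun j => ?_, fun j hj => ?_⟩
  · rw [flipCoord_apply]
    split_ifs
    · rcases hu.1 i with h | h <;> simp [h]
    · exact hu.1 j
  · rw [flipCoord_apply, if_neg (by omega)]
    exact hu.2 j hj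

lemma flipCoord_injective {n : ℕ} {u : ℕ →₀ ℤ} (hu : u ∈ cubeVertices n) :
    Function.Injective (flipCoord u) := by
  intro i j h
  by_contra hij
  have h' := DFunLike.congr_fun h i
  rw [flipCoord_apply, flipCoord_apply, if_pos rfl, if_neg hij] at h'
  rcases hu.1 i with h1 | h1 <;> simp [h1] at h'

lemma l1Norm_sub_eq_card {n : ℕ} {u w : ℕ →₀ ℤ} (hu : u ∈ cubeVertices n)
    (hw : w ∈ cubeVertices n) : l1Norm (u - w) = ((u - w).support.card : ℤ) := by
  have h : ∀ i ∈ (u - w).support, |(u - w) i| = 1 := by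
    intro i hi
    rw [Finsupp.mem_support_iff, Finsupp.sub_apply] at hi
    rw [Finsupp.sub_apply]
    rcases hu.1 i with h1 | h1 <;> rcases hw.1 i with h2 | h2 <;> simp_all
  rw [l1Norm, Finsupp.sum, Finset.sum_congr rfl h]
  simp

lemma l1Norm_sub_eq_one_iff {n : ℕ} {u w : ℕ →₀ ℤ} (hu : u ∈ cubeVertices n)
    (hw : w ∈ cubeVertices n) : l1Norm (u - w) = 1 ↔ ∃ i < n, flipCoord u i = w := by
  rw [l1Norm_sub_eq_card hu hw, Nat.cast_eq_one, Finset.card_eq_one]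
  have hsupp : ∀ j, j ∈ (u - w).support ↔ u j ≠ w j := by
    intro j
    rw [Finsupp.mem_support_iff, Finsupp.sub_apply, sub_ne_zero]
  constructor
  · rintro ⟨i, hi⟩
    simp only [hi, Finset.mem_singleton] at hsupp
    have hne : u i ≠ w i := (hsupp i).1 rfl
    refine ⟨i, ?_, ?_⟩
    · by_contra hin
      exact hne (by rw [hu.2 i (by omega), hw.2 i (by omega)])
    · ext j
      rw [flipCoord_apply]
      split_ifs with hj
      · subst hj
        rcases hu.1 j with h1 | h1 <;> rcases hw.1 j with h2 | h2 <;> simp_all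
      · by_contra hne'
        exact hj ((hsupp j).2 hne')
  · rintro ⟨i, hi, rfl⟩
    refine ⟨i, ?_⟩
    ext j
    rw [hsupp, flipCoord_apply, Finset.mem_singleton]
    split_ifs with hj
    · subst hj
      rcases hu.1 j with h1 | h1 <;> simp [h1]
    · simp [hj]

lemma cubeTransition_nonneg (n : ℕ) (u w : ℕ →₀ ℤ) : 0 ≤ cubeTransition n u w := by
  unfold cubeTransition
  split_ifs <;> positivity

lemma sum_cubeTransition_mul {n : ℕ} {u : ℕ →₀ ℤ} (hu : u ∈ cubeVertices n)
    (φ : (ℕ →₀ ℤ) → ℝ) :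
    ∑ w ∈ (finite_cubeVertices n).toFinset, cubeTransition n u w * φ w =
      (1 / n) * ∑ i ∈ Finset.range n, φ (flipCoord u i) := by
  classical
  rw [Finset.mul_sum, ← Finset.sum_image (s := Finset.range n) (g := flipCoord u)
    (f := fun w => 1 / (n : ℝ) * φ w) ((flipCoord_injective hu).injOn)]
  symm
  have hsub : (Finset.range n).image (flipCoord u) ⊆ (finite_cubeVertices n).toFinset := by
    intro w hw
    obtain ⟨i, hi, rfl⟩ := Finset.mem_image.1 hw
    simpa using flipCoord_mem hu (Finset.mem_range.1 hi)
  rw [← Finset.sum_subset hsub]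
  · refine Finset.sum_congr rfl fun w hw => ?_
    have hw' := hsub hw
    rw [Set.Finite.mem_toFinset] at hw'
    rw [cubeTransition, if_pos ⟨hu, hw', (l1Norm_sub_eq_one_iff hu hw').2 (by simpa using hw)⟩]
  · intro w hw hni
    rw [Set.Finite.mem_toFinset] at hw
    rw [cubeTransition, if_neg, zero_mul]
    rintro ⟨-, -, h⟩
    exact hni (by simpa using (l1Norm_sub_eq_one_iff hu hw).1 h)

/-- The set of coordinates below `n` in which two vectors differ. -/
def diffCoords (n : ℕ) (u v : ℕ →₀ ℤ) : Finset ℕ := (Finset.range n).filter fun i => u i ≠ v i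

lemma diffCoords_card_le (n : ℕ) (u v : ℕ →₀ ℤ) : (diffCoords n u v).card ≤ n :=
  (Finset.card_filter_le _ _).trans (Finset.card_range n).le

lemma diffCoords_nonempty {n : ℕ} {u v : ℕ →₀ ℤ} (hu : u ∈ cubeVertices n)
    (hv : v ∈ cubeVertices n) (h : u ≠ v) : (diffCoords n u v).Nonempty := by
  obtain ⟨i, hi⟩ : ∃ i, u i ≠ v i := by
    by_contra! hall
    exact h (Finsupp.ext hall)
  refine ⟨i, ?_⟩
  rw [diffCoords, Finset.mem_filter, Finset.mem_range]
  refine ⟨?_, hi⟩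
  by_contra hin
  exact hi (by rw [hu.2 i (by omega), hv.2 i (by omega)])

lemma diffCoords_flipCoord {n : ℕ} {u v : ℕ →₀ ℤ} (hu : u ∈ cubeVertices n)
    (hv : v ∈ cubeVertices n) {i : ℕ} (hi : i < n) :
    diffCoords n (flipCoord u i) v =
      if i ∈ diffCoords n u v then (diffCoords n u v).erase i else insert i (diffCoords n u v) := by
  ext j
  by_cases hji : j = i
  · subst hji
    rcases hu.1 j with h1 | h1 <;> rcases hv.1 j with h2 | h2 <;>
      simp [diffCoords, flipCoord_apply, h1, h2, hi]
  · split_ifs <;> simp [diffCoords, flipCoord_apply, hji]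

/-- The mean of the hitting time of `v` after one step is the hitting time minus one. -/
lemma sum_cubeTransition_mul_hittingTime {N : ℕ} {u v : ℕ →₀ ℤ} (hu : u ∈ cubeVertices (N + 1))
    (hv : v ∈ cubeVertices (N + 1)) (h : u ≠ v) :
    ∑ w ∈ (finite_cubeVertices (N + 1)).toFinset,
        cubeTransition (N + 1) u w * hittingTime N (diffCoords (N + 1) w v).card =
      hittingTime N (diffCoords (N + 1) u v).card - 1 := by
  rw [sum_cubeTransition_mul hu fun w => hittingTime N (diffCoords (N + 1) w v).card]
  set A := diffCoords (N + 1) u v with hA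
  obtain ⟨j, hj⟩ : ∃ j, A.card = j + 1 :=
    ⟨A.card - 1, by have : 0 < A.card := (diffCoords_nonempty hu hv h).card_pos; omega⟩
  have hjN : j ≤ N := by have : A.card ≤ N + 1 := diffCoords_card_le (N + 1) u v; omega
  -- Flipping one of the `j + 1` differing coordinates gives distance `j`; flipping any other gives
  -- `j + 2`.
  have hterm : ∀ i ∈ Finset.range (N + 1),
      hittingTime N (diffCoords (N + 1) (flipCoord u i) v).card =
        if i ∈ A then hittingTime N j else hittingTime N (j + 2) := by
    intro i hi
    rw [diffCoords_flipCoord hu hv (Finset.mem_range.1 hi), ← hA]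
    split_ifs with hiA
    · rw [Finset.card_erase_of_mem hiA, hj, Nat.add_sub_cancel]
    · rw [Finset.card_insert_of_notMem hiA, hj]
  have hAsub : A ⊆ Finset.range (N + 1) := Finset.filter_subset _ _
  have hc : (Finset.range (N + 1)).filter (· ∈ A) = A := by
    rw [Finset.filter_mem_eq_inter, Finset.inter_eq_right.2 hAsub]
  have hc' : (((Finset.range (N + 1)).filter (· ∉ A)).card : ℝ) = N - j := by
    rw [Finset.filter_notMem_eq_sdiff, Finset.card_sdiff_of_subset hAsub, Finset.card_range, hj,
      Nat.add_sub_add_right, Nat.cast_sub hjN]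
  rw [Finset.sum_congr rfl hterm, Finset.sum_ite, Finset.sum_const, Finset.sum_const, hc,
    nsmul_eq_mul, nsmul_eq_mul, hc', hj]
  push_cast
  rw [hittingTime_harmonic hjN]
  have : (N : ℝ) + 1 ≠ 0 := by positivity
  field_simp

/-! ### Random walks on growing graphs -/

/-- The first `t + 1` positions of a process. -/
def history {S Ω : Type*} (X : ℕ → Ω → S) (t : ℕ) (ω : Ω) : Fin (t + 1) → S := fun i => X i ω

lemma phaseEnd_succ (d : ℕ → ℕ) (n : ℕ) : phaseEnd d (n + 1) = phaseEnd d n + d (n + 1) := by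
  rw [phaseEnd, phaseEnd, Finset.sum_Icc_succ_top (by omega)]

lemma exists_phase {d : ℕ → ℕ} {n t : ℕ} (ht : t < phaseEnd d n) :
    ∃ k < n, phaseEnd d k ≤ t ∧ t < phaseEnd d (k + 1) := by
  induction n with
  | zero => simp [phaseEnd] at ht
  | succ n ih =>
    rcases lt_or_ge t (phaseEnd d n) with h | h
    · obtain ⟨k, hk, h'⟩ := ih h
      exact ⟨k, by omega, h'⟩
    · exact ⟨n, by omega, h, ht⟩

namespace IsGrowingGraphWalk

variable {S : Type*} [Countable S] {d : ℕ → ℕ} {P : ℕ → S → S → ℝ} {x₀ : S}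
  {Ω : Type*} [MeasurableSpace Ω] {μ : Measure Ω} {X : ℕ → Ω → S}

lemma measurableSet_history_eq (hX : IsGrowingGraphWalk d P x₀ μ X) (t : ℕ)
    (w : Fin (t + 1) → S) : MeasurableSet (history X t ⁻¹' {w}) := by
  have : history X t ⁻¹' {w} = ⋂ i : Fin (t + 1), {ω | X i ω = w i} := by
    ext ω
    simp [history, funext_iff]
  rw [this]
  exact MeasurableSet.iInter fun i => hX.measurableSet_eq i (w i)

lemma measurableSet_history (hX : IsGrowingGraphWalk d P x₀ μ X) (t : ℕ)
    (B : Set (Fin (t + 1) → S)) : MeasurableSet (history X t ⁻¹' B) := by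
  rw [← Set.biUnion_preimage_singleton]
  exact MeasurableSet.biUnion B.to_countable fun w _ => hX.measurableSet_history_eq t w

/-- The Markov property. -/
lemma measureReal_step [IsFiniteMeasure μ] (hX : IsGrowingGraphWalk d P x₀ μ X)
    {n t : ℕ} (hnt : phaseEnd d n ≤ t) (htn : t < phaseEnd d (n + 1))
    (B : Set (Fin (t + 1) → S)) (x y : S) (hP : 0 ≤ P (n + 1) x y) :
    μ.real (history X t ⁻¹' B ∩ {ω | X t ω = x} ∩ {ω | X (t + 1) ω = y}) =
      μ.real (history X t ⁻¹' B ∩ {ω | X t ω = x}) * P (n + 1) x y := by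
  classical
  set C : Set (Fin (t + 1) → S) := {w | w ∈ B ∧ w (Fin.last t) = x} with hC
  have hpre : history X t ⁻¹' B ∩ {ω | X t ω = x} = history X t ⁻¹' C := by
    ext ω
    simp [hC, history]
  have hsum : ∀ w ∈ C, μ.restrict {ω | X (t + 1) ω = y} (history X t ⁻¹' {w}) =
      μ (history X t ⁻¹' {w}) * ENNReal.ofReal (P (n + 1) x y) := by
    rintro w ⟨-, hwx⟩
    set p : ℕ → S := fun s => if h : s < t + 1 then w ⟨s, h⟩ else y with hp
    have hpt : p t = x := by simpa [hp, Fin.last] using hwx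
    have hpt' : p (t + 1) = y := by simp [hp]
    have h1 : {ω | ∀ s ≤ t, X s ω = p s} = history X t ⁻¹' {w} := by
      ext ω
      simp only [Set.mem_ofPred_eq, Set.mem_preimage, Set.mem_singleton_iff, funext_iff, history]
      constructor
      · intro h i
        rw [h i (by omega)]
        exact dif_pos i.2
      · intro h s hs
        rw [show p s = w ⟨s, by omega⟩ from dif_pos (Nat.lt_succ_of_le hs)]
        exact h ⟨s, by omega⟩
    have h2 : {ω | ∀ s ≤ t + 1, X s ω = p s} =
        history X t ⁻¹' {w} ∩ {ω | X (t + 1) ω = y} := by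
      rw [← h1, ← hpt']
      ext ω
      constructor
      · exact fun h => ⟨fun s hs => h s (by omega), h (t + 1) le_rfl⟩
      · rintro ⟨h, h'⟩ s hs
        rcases Nat.le_succ_iff.1 hs with hs | rfl
        · exact h s hs
        · exact h'
    have h3 := hX.step n t hnt htn p
    rw [h1, h2, hpt, hpt'] at h3
    rw [Measure.restrict_apply (hX.measurableSet_history_eq t w),
      ← ENNReal.ofReal_toReal (measure_ne_top μ (history X t ⁻¹' {w})),
      ← ENNReal.ofReal_mul ENNReal.toReal_nonneg, ← measureReal_def, ← h3, measureReal_def,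
      ENNReal.ofReal_toReal (measure_ne_top μ _)]
  -- The walk's `step` law concerns single trajectories; countability of `S` allows summing it over
  -- all histories in `C`.
  have key : μ (history X t ⁻¹' C ∩ {ω | X (t + 1) ω = y}) =
      μ (history X t ⁻¹' C) * ENNReal.ofReal (P (n + 1) x y) := by
    rw [← Measure.restrict_apply (hX.measurableSet_history t C),
      ← tsum_measure_preimage_singleton C.to_countable
        (fun w _ => hX.measurableSet_history_eq t w),
      ← tsum_measure_preimage_singleton C.to_countable
        (fun w _ => hX.measurableSet_history_eq t w), ← ENNReal.tsum_mul_right]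
    exact tsum_congr fun w => hsum w w.2
  rw [hpre, measureReal_def, key, ENNReal.toReal_mul, ENNReal.toReal_ofReal hP, measureReal_def]

lemma measureReal_eq_sum [IsFiniteMeasure μ] (hX : IsGrowingGraphWalk d P x₀ μ X) {t : ℕ}
    {V : Finset S} (hV : ∀ᵐ ω ∂μ, X t ω ∈ V) (F : Set Ω) :
    μ.real F = ∑ x ∈ V, μ.real (F ∩ {ω | X t ω = x}) := by
  -- Restricting `μ` to `F` leaves only the fibres of `X t` to be measurable, so `F` may be
  -- arbitrary.
  have h := sum_measureReal_preimage_singleton (μ := μ.restrict F) V (f := X t)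
    (fun x _ => hX.measurableSet_eq t x)
  have hmeas : MeasurableSet (X t ⁻¹' (V : Set S)) := by
    rw [← Set.biUnion_preimage_singleton]
    exact MeasurableSet.biUnion (Set.to_countable _) fun x _ => hX.measurableSet_eq t x
  rw [measureReal_restrict_apply hmeas] at h
  rw [show μ.real F = μ.real (X t ⁻¹' (V : Set S) ∩ F) from ?_, ← h]
  · refine Finset.sum_congr rfl fun x _ => ?_
    rw [Set.inter_comm]
    exact measureReal_restrict_apply (hX.measurableSet_eq t x)
  · refine measureReal_congr ?_
    filter_upwards [hV] with ω hω
    exact propext ⟨fun hF => ⟨hω, hF⟩, fun h => h.2⟩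

end IsGrowingGraphWalk

/-! ### The walk on the growing hypercube -/

section Hypercube

variable {d : ℕ → ℕ} {Ω : Type*} [MeasurableSpace Ω] {μ : Measure Ω} [IsProbabilityMeasure μ]
  {X : ℕ → Ω → (ℕ →₀ ℤ)}

/-- The last step alone decides: it follows a transition matrix of dimension at most `n`, whose
entries outside that cube are zero. -/
lemma ae_mem_cubeVertices (hX : IsGrowingGraphWalk d cubeTransition 0 μ X) {n t : ℕ}
    (ht : t ≤ phaseEnd d n) : ∀ᵐ ω ∂μ, X t ω ∈ cubeVertices n := by
  cases t with
  | zero =>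
    filter_upwards [hX.start] with ω hω
    rw [hω]
    exact ⟨fun i => Or.inl rfl, fun i _ => rfl⟩
  | succ t =>
    obtain ⟨k, hk, hkt, htk⟩ := exists_phase (Nat.lt_of_succ_le ht)
    have hnull : ∀ x y, y ∉ cubeVertices n → ∀ᵐ ω ∂μ, ¬ (X t ω = x ∧ X (t + 1) ω = y) := by
      intro x y hy
      have h := hX.measureReal_step hkt htk Set.univ x y (cubeTransition_nonneg _ _ _)
      have hzero : cubeTransition (k + 1) x y = 0 :=
        if_neg fun h => hy (cubeVertices_mono hk h.2.1)
      rw [hzero, mul_zero, Set.preimage_univ, Set.univ_inter,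
        measureReal_eq_zero_iff] at h
      rw [ae_iff]
      simp only [not_not]
      exact h
    have hall : ∀ᵐ ω ∂μ, ∀ x y, y ∉ cubeVertices n → ¬ (X t ω = x ∧ X (t + 1) ω = y) := by
      rw [ae_all_iff]
      intro x
      rw [ae_all_iff]
      intro y
      by_cases hy : y ∈ cubeVertices n
      · exact Eventually.of_forall fun ω h => absurd hy h
      · filter_upwards [hnull x y hy] with ω hω _ using hω
    filter_upwards [hall] with ω hω
    by_contra hni
    exact hω _ _ hni ⟨rfl, rfl⟩

/-- The event that the process avoids `v` between the times `T` and `t`. -/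
def avoids {S Ω : Type*} (X : ℕ → Ω → S) (v : S) (T t : ℕ) : Set Ω :=
  {ω | ∀ s, T ≤ s → s ≤ t → X s ω ≠ v}

lemma avoids_eq_preimage {S Ω : Type*} (X : ℕ → Ω → S) (v : S) (T t : ℕ) :
    avoids X v T t =
      history X t ⁻¹' {w | ∀ i : Fin (t + 1), T ≤ (i : ℕ) → w i ≠ v} := by
  ext ω
  exact ⟨fun h i hi => h i hi (by omega), fun h s hs hst => h ⟨s, by omega⟩ hs⟩

lemma avoids_inter_eq_of_ne {S Ω : Type*} (X : ℕ → Ω → S) {v : S} {T t : ℕ} {y : S}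
    (hy : y ≠ v) :
    avoids X v T (t + 1) ∩ {ω | X (t + 1) ω = y} = avoids X v T t ∩ {ω | X (t + 1) ω = y} := by
  ext ω
  constructor
  · exact fun h => ⟨fun s hs hst => h.1 s hs (by omega), h.2⟩
  · rintro ⟨h, h'⟩
    refine ⟨fun s hs hst => ?_, h'⟩
    rcases Nat.le_succ_iff.1 hst with hst | rfl
    · exact h s hs hst
    · exact fun he => hy (h'.symm.trans he)

lemma avoids_inter_eq_empty {S Ω : Type*} (X : ℕ → Ω → S) {v : S} {T t : ℕ} (h : T ≤ t) :
    avoids X v T t ∩ {ω | X t ω = v} = ∅ :=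
  Set.eq_empty_of_forall_notMem fun _ hω => hω.1 t h le_rfl hω.2

/-- The mean remaining hitting time of `v` in the `(n + 1)`-dimensional hypercube at time `t`, on
the event that `v` was avoided since the time `T`. -/
noncomputable def meanRemainingTime (μ : Measure Ω) (X : ℕ → Ω → (ℕ →₀ ℤ)) (v : ℕ →₀ ℤ)
    (n T t : ℕ) : ℝ :=
  ∑ x ∈ (finite_cubeVertices (n + 1)).toFinset,
    μ.real (avoids X v T t ∩ {ω | X t ω = x}) * hittingTime n (diffCoords (n + 1) x v).card

lemma meanRemainingTime_nonneg {Ω : Type*} [MeasurableSpace Ω] (μ : Measure Ω)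
    (X : ℕ → Ω → (ℕ →₀ ℤ)) (v : ℕ →₀ ℤ) (n T t : ℕ) :
    0 ≤ meanRemainingTime μ X v n T t :=
  Finset.sum_nonneg fun _ _ => mul_nonneg measureReal_nonneg (hittingTime_nonneg _ _)

lemma meanRemainingTime_le (hX : IsGrowingGraphWalk d cubeTransition 0 μ X) (v : ℕ →₀ ℤ)
    {n t : ℕ} (T : ℕ) (ht : t ≤ phaseEnd d (n + 1)) :
    meanRemainingTime μ X v n T t ≤ 3 * 2 ^ (n + 1) := by
  have hV : ∀ᵐ ω ∂μ, X t ω ∈ (finite_cubeVertices (n + 1)).toFinset := by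
    simpa using ae_mem_cubeVertices hX ht
  calc meanRemainingTime μ X v n T t
      ≤ ∑ x ∈ (finite_cubeVertices (n + 1)).toFinset,
          μ.real (avoids X v T t ∩ {ω | X t ω = x}) * (3 * 2 ^ (n + 1)) :=
        Finset.sum_le_sum fun x _ => mul_le_mul_of_nonneg_left
          (hittingTime_le (diffCoords_card_le _ _ _)) measureReal_nonneg
    _ = μ.real (avoids X v T t) * (3 * 2 ^ (n + 1)) := by
        rw [← Finset.sum_mul, ← hX.measureReal_eq_sum hV]
    _ ≤ 3 * 2 ^ (n + 1) := mul_le_of_le_one_left (by positivity) measureReal_le_one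

/-- Paths reaching `v` at time `t + 1` leave the event but carry hitting time zero, so dropping them
costs nothing and equality holds. -/
lemma meanRemainingTime_succ (hX : IsGrowingGraphWalk d cubeTransition 0 μ X) {v : ℕ →₀ ℤ}
    {n T t : ℕ} (hv : v ∈ cubeVertices (n + 1)) (hT : T ≤ t) (hnt : phaseEnd d n ≤ t)
    (htn : t < phaseEnd d (n + 1)) :
    meanRemainingTime μ X v n T (t + 1) =
      meanRemainingTime μ X v n T t - μ.real (avoids X v T t) := by
  set V := (finite_cubeVertices (n + 1)).toFinset with hVdef
  have hV : ∀ᵐ ω ∂μ, X t ω ∈ V := by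
    simpa [hVdef] using ae_mem_cubeVertices hX htn.le
  have hzero : hittingTime n (diffCoords (n + 1) v v).card = 0 := by
    simp [hittingTime, diffCoords]
  have hstep : ∀ y ∈ V, μ.real (avoids X v T (t + 1) ∩ {ω | X (t + 1) ω = y}) *
        hittingTime n (diffCoords (n + 1) y v).card =
      ∑ x ∈ V, μ.real (avoids X v T t ∩ {ω | X t ω = x}) *
        (cubeTransition (n + 1) x y * hittingTime n (diffCoords (n + 1) y v).card) := by
    intro y _
    by_cases hy : y = v
    · subst hy
      simp [hzero]
    · simp only [← mul_assoc]
      rw [avoids_inter_eq_of_ne X hy, hX.measureReal_eq_sum hV, Finset.sum_mul]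
      refine Finset.sum_congr rfl fun x _ => ?_
      rw [Set.inter_right_comm, avoids_eq_preimage,
        hX.measureReal_step hnt htn _ x y (cubeTransition_nonneg _ _ _)]
  rw [meanRemainingTime, meanRemainingTime, ← hVdef, Finset.sum_congr rfl hstep,
    Finset.sum_comm, hX.measureReal_eq_sum hV, ← Finset.sum_sub_distrib]
  refine Finset.sum_congr rfl fun x hx => ?_
  rw [← Finset.mul_sum]
  by_cases hxv : x = v
  · subst hxv
    simp [avoids_inter_eq_empty X hT]
  · rw [sum_cubeTransition_mul_hittingTime (by simpa [hVdef] using hx) hv hxv]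
    ring

/-- The probability that `v` is not hit in a phase is at most the maximal mean hitting time divided
by the duration of the phase. -/
lemma duration_mul_measureReal_le (hX : IsGrowingGraphWalk d cubeTransition 0 μ X) {v : ℕ →₀ ℤ}
    {n : ℕ} (hv : v ∈ cubeVertices (n + 1)) :
    d (n + 1) * μ.real {ω | ∀ s, phaseEnd d n ≤ s → X s ω ≠ v} ≤ 3 * 2 ^ (n + 1) := by
  set T := phaseEnd d n with hT
  have hend : phaseEnd d (n + 1) = T + d (n + 1) := phaseEnd_succ d n
  -- Each step's decrease is at least the probability of avoiding `v` forever after `T`, which does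
  -- not depend on `k`.
  have hsum : ∀ k ≤ d (n + 1), k * μ.real {ω | ∀ s, T ≤ s → X s ω ≠ v} +
      meanRemainingTime μ X v n T (T + k) ≤ meanRemainingTime μ X v n T T := by
    intro k
    induction k with
    | zero => simp
    | succ k ih =>
      intro hk
      have h := ih (by omega)
      have hmono : μ.real {ω | ∀ s, T ≤ s → X s ω ≠ v} ≤ μ.real (avoids X v T (T + k)) :=
        measureReal_mono fun ω hω s hs _ => hω s hs
      rw [← add_assoc, meanRemainingTime_succ hX hv (by omega) (by omega) (by omega)]
      push_cast
      linarith
  have h1 := hsum _ le_rfl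
  have h2 := meanRemainingTime_le hX v (t := T) (n := n) T (by omega)
  have h3 := meanRemainingTime_nonneg μ X v n T (T + d (n + 1))
  linarith

end Hypercube

theorem proposition5p10 (d : ℕ → ℕ)
    (hd : (fun n : ℕ => (n : ℝ) * 2 ^ n) =O[atTop] fun n : ℕ => (d n : ℝ))
    {Ω : Type*} [MeasurableSpace Ω] (μ : Measure Ω) [IsProbabilityMeasure μ]
    (X : ℕ → Ω → (ℕ →₀ ℤ)) (hX : IsGrowingGraphWalk d cubeTransition 0 μ X)
    (m : ℕ) (hm : 1 ≤ m) (v : ℕ →₀ ℤ) (hv : v ∈ cubeVertices m) :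
    ∀ᵐ ω ∂μ, {t : ℕ | X t ω = v}.Infinite := by
  obtain ⟨c, hc, hb⟩ := hd.exists_pos
  obtain ⟨n₀, hn₀⟩ := eventually_atTop.1 hb.bound
  have hdur : ∀ n, n₀ ≤ n → (n : ℝ) * 2 ^ n ≤ c * d n := by
    intro n hn
    have h := hn₀ n hn
    rwa [Real.norm_of_nonneg (by positivity), Real.norm_of_nonneg (by positivity)] at h
  have hle : ∀ n, n₀ ≤ n → m ≤ n →
      (n + 1) * μ.real {ω | ∀ s, phaseEnd d n ≤ s → X s ω ≠ v} ≤ 3 * c := by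
    intro n hn hmn
    have h1 := duration_mul_measureReal_le hX (n := n) (cubeVertices_mono (by omega) hv)
    have h2 := hdur (n + 1) (by omega)
    set q := μ.real {ω | ∀ s, phaseEnd d n ≤ s → X s ω ≠ v}
    have hq : 0 ≤ q := measureReal_nonneg
    push_cast at h2
    refine le_of_mul_le_mul_right ?_ (by positivity : (0 : ℝ) < 2 ^ (n + 1))
    calc (n + 1) * q * 2 ^ (n + 1) = ((n + 1) * 2 ^ (n + 1)) * q := by ring
      _ ≤ c * d (n + 1) * q := mul_le_mul_of_nonneg_right h2 hq
      _ = c * (d (n + 1) * q) := by ring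
      _ ≤ c * (3 * 2 ^ (n + 1)) := mul_le_mul_of_nonneg_left h1 hc.le
      _ = 3 * c * 2 ^ (n + 1) := by ring
  have hpos : ∀ n, n₀ ≤ n → 1 ≤ n → 1 ≤ d n := by
    intro n hn h1
    by_contra h0
    have h := hdur n hn
    rw [show d n = 0 by omega, Nat.cast_zero, mul_zero] at h
    have : (0 : ℝ) < n := by exact_mod_cast h1
    have : (0 : ℝ) < n * 2 ^ n := by positivity
    linarith
  -- Late phases are nonempty, so phases start after any given time.
  have hgrow : ∀ k, k ≤ phaseEnd d (n₀ + k) := by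
    intro k
    induction k with
    | zero => omega
    | succ k ih =>
      rw [← add_assoc, phaseEnd_succ]
      have := hpos (n₀ + k + 1) (by omega) (by omega)
      omega
  have hnull : ∀ N, μ.real {ω | ∀ s, N ≤ s → X s ω ≠ v} = 0 := by
    intro N
    set r := μ.real {ω | ∀ s, N ≤ s → X s ω ≠ v}
    refine le_antisymm (le_of_forall_pos_le_add fun ε hε => ?_) measureReal_nonneg
    obtain ⟨k, hk⟩ := exists_nat_ge (3 * c / ε)
    -- Large enough for the duration bound, for `v` to lie in the cube, for the phase to start after
    -- `N`, and for `3 * c / ε ≤ n`.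
    set n := n₀ + (N + m + k)
    have hN : N ≤ phaseEnd d n := le_trans (by omega) (hgrow (N + m + k))
    have hmono : r ≤ μ.real {ω | ∀ s, phaseEnd d n ≤ s → X s ω ≠ v} :=
      measureReal_mono fun ω hω s hs => hω s (hN.trans hs)
    have h := hle n (by omega) (by omega)
    have hkn : (k : ℝ) ≤ n := by exact_mod_cast (by omega : k ≤ n)
    have hε' : 3 * c ≤ (n + 1) * ε := by
      rw [div_le_iff₀ hε] at hk
      nlinarith
    have hn : (0 : ℝ) < n + 1 := by positivity
    rw [zero_add]
    exact hmono.trans (le_of_mul_le_mul_left (h.trans hε') hn)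
  have hae : ∀ᵐ ω ∂μ, ∀ N, ¬ ∀ s, N ≤ s → X s ω ≠ v := by
    rw [ae_all_iff]
    intro N
    rw [ae_iff]
    simpa only [not_not] using (measureReal_eq_zero_iff).1 (hnull N)
  filter_upwards [hae] with ω hω
  rw [← Nat.frequently_atTop_iff_infinite, frequently_atTop]
  intro N
  have := hω N
  push Not at this
  exact this
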